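/- Let $n\ge 0$. For a matrix $A\in\mathbb{C}^{n\times n}$ and a set $\alpha\subseteq\{1,\dots,n\}$ let $A[\alpha]$ denote the principal minor of $A$ with rows and columns indexed by $\alpha$ (with $A[\emptyset]=1$), and let $$c_j(A)=\binom{n}{j}^{-1}\sum_{\#\alpha=j}A[\alpha],\qquad j=0,\dots,n,$$ be the normalized coefficients of the characteristic polynomial of $A$ (so that $\det(xI-A)=\sum_{j=0}^n(-1)^j\binom{n}{j}c_j(A)x^{n-j}$). A matrix $M \in \mathbb{R}^{n\times n}$ is called an $M$-matrix (possibly singular) if all its principal minors are nonnegative and all its off-diagonal entries are nonpositive; it is called an inverse $M$-matrix if it is invertible and $M^{-1}$ is an $M$-matrix. Theorem. Let $A\in\mathbb{C}^{n\times n}$ be similar (over $\mathbb{C}$) to an $M$-matrix or to an inverse $M$-matrix. Then the numbers $c_0(A),\dots,c_n(A)$ are real and satisfy Newton's inequalities $$c_j(A)^2\ge c_{j-1}(A)\,c_{j+1}(A),\qquad j=1,\dots,n-1.$$ -/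

import Mathlib

namespace NewtonMMatrix

/-- The principal minor `A[α]`: the determinant of the submatrix of `A` whose rows and columns are
indexed by `α`.  For `α = ∅` its value is `1`. -/
def principalMinor {R : Type*} [CommRing R] {n : ℕ} (A : Matrix (Fin n) (Fin n) R)
    (α : Finset (Fin n)) : R :=
  (A.submatrix (fun i : α => (i : Fin n)) (fun i : α => (i : Fin n))).det

/-- (Possibly singular) M-matrices: all principal minors are nonnegative and all off-diagonal
entries are nonpositive.  Such matrices are real, since the diagonal entries are principal minors
and the off-diagonal entries are nonpositive. -/
def IsMMatrix {n : ℕ} (M : Matrix (Fin n) (Fin n) ℝ) : Prop :=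
  (∀ α : Finset (Fin n), 0 ≤ principalMinor M α) ∧ ∀ i j, i ≠ j → M i j ≤ 0

/-- Inverse M-matrices: invertible matrices whose inverse is an M-matrix. -/
def IsInverseMMatrix {n : ℕ} (M : Matrix (Fin n) (Fin n) ℝ) : Prop :=
  IsUnit M ∧ IsMMatrix M⁻¹

/-- Similarity of complex matrices: `A = S * B * S⁻¹` for some invertible complex `S`. -/
def Similar {n : ℕ} (A B : Matrix (Fin n) (Fin n) ℂ) : Prop :=
  ∃ S : Matrix (Fin n) (Fin n) ℂ, IsUnit S ∧ A = S * B * S⁻¹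

/-- The normalized coefficient `c_j(A)` of the characteristic polynomial: the sum of all `j × j`
principal minors of `A`, divided by the binomial coefficient `n choose j`. -/
noncomputable def normCoeff {n : ℕ} (A : Matrix (Fin n) (Fin n) ℂ) (j : ℕ) : ℂ :=
  (∑ α ∈ Finset.powersetCard j (Finset.univ : Finset (Fin n)), principalMinor A α) /
    (n.choose j : ℂ)

end NewtonMMatrix

/-! Let E_k be the sum of the principal minors of order k. Similarity preserves the E_k, and
inversion reverses their order up to the factor det, so real M-matrices suffice. Adding εI makes all
principal minors positive; ε → 0 recovers the singular case.

Group pairs (α, β) by γ = α ∩ β and η = α ∆ β. For fixed γ and η, `sum_pminor_union_step` compares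
the averages of A[γ ∪ a] A[γ ∪ (η \ a)] over |a| = p and |a| = p + 1. Schur complements remove γ,
and column scaling makes row sums nonnegative. Each row is then a nonnegative combination of e_i and
the e_i - e_j. Both sides are multilinear in the rows, so it suffices to treat I minus the adjacency
matrix of a partial function. There a minor is 0 or 1 according as its index set contains a cycle or
not, and the claim becomes `card_splitting_step`, a count of sets that split every cycle.

This bounds E_j E_{j+2} by the sum of A[α] A[β] (1 - 1/(|α \ β| + 1)) over pairs of order j + 1. By
`sq_sum_le_kernel` the subtracted part is at least E_{j+1}^2 times the average of the kernel, which
yields exactly Newton's constant. -/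

namespace NewtonMMatrix

/-! ### Counting the sets that split a disjoint family -/

/-- The `q`-element subsets of `V` that split every member of `𝒞`: they contain none of them and
meet all of them. -/
def splitting {ι : Type*} [DecidableEq ι] (V : Finset ι) (𝒞 : Finset (Finset ι)) (q : ℕ) :
    Finset (Finset ι) :=
  (V.powersetCard q).filter fun a => ∀ C ∈ 𝒞, ¬ C ⊆ a ∧ ¬ Disjoint C a

section Splitting

variable {ι : Type*} [DecidableEq ι] {V : Finset ι} {𝒞 : Finset (Finset ι)}

lemma mem_splitting {q : ℕ} {a : Finset ι} :
    a ∈ splitting V 𝒞 q ↔ (a ⊆ V ∧ a.card = q) ∧ ∀ C ∈ 𝒞, ¬ C ⊆ a ∧ ¬ Disjoint C a := by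
  simp [splitting, Finset.mem_powersetCard]

/-- Complementation in V exchanges "contains C" with "misses C", so it preserves splitting. -/
lemma card_splitting_symm (hV : ∀ C ∈ 𝒞, C ⊆ V) {p q : ℕ} (h : p + q = V.card) :
    (splitting V 𝒞 p).card = (splitting V 𝒞 q).card := by
  have key : ∀ p q : ℕ, p + q = V.card → ∀ a ∈ splitting V 𝒞 p, V \ a ∈ splitting V 𝒞 q := by
    intro p q h a ha
    rw [mem_splitting] at ha ⊢
    obtain ⟨⟨haV, hac⟩, hsp⟩ := ha
    refine ⟨⟨Finset.sdiff_subset, ?_⟩, fun C hC => ⟨fun hCa => ?_, fun hCa => ?_⟩⟩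
    · rw [Finset.card_sdiff_of_subset haV]; omega
    · exact (hsp C hC).2 (Finset.disjoint_of_subset_left hCa Finset.sdiff_disjoint)
    · refine (hsp C hC).1 fun x hx => ?_
      by_contra hxa
      exact Finset.disjoint_left.1 hCa hx (Finset.mem_sdiff.2 ⟨hV C hC hx, hxa⟩)
  refine Finset.card_nbij' (fun a => V \ a) (fun a => V \ a) (key p q h)
    (key q p (by omega)) ?_ ?_
  · intro a ha
    exact Finset.sdiff_sdiff_eq_self (mem_splitting.1 ha).1.1
  · intro a ha
    exact Finset.sdiff_sdiff_eq_self (mem_splitting.1 ha).1.1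

/-- A sequence that is symmetric about `N / 2` and increases up to there is unimodal. -/
lemma le_of_symm_of_step {N : ℕ} {M : ℕ → ℕ} (hs : ∀ p q, p + q = N → M p = M q)
    (hm : ∀ p, 2 * p + 1 ≤ N → M p ≤ M (p + 1)) {p q : ℕ} (hpq : p ≤ q) (h : p + q ≤ N) :
    M p ≤ M q := by
  have chain : ∀ d p, 2 * (p + d) ≤ N + 1 → M p ≤ M (p + d) := by
    intro d
    induction d with
    | zero => intro p _; exact le_rfl
    | succ d ih =>
      intro p hp
      exact (ih p (by omega)).trans (hm (p + d) (by omega))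
  by_cases hq : 2 * q ≤ N + 1
  · have := chain (q - p) p (by omega)
    rwa [show p + (q - p) = q by omega] at this
  · rw [hs q (N - q) (by omega)]
    have := chain (N - q - p) p (by omega)
    rwa [show p + (N - q - p) = N - q by omega] at this

/-- Adding x sends the left family to the right one unless it completes the member C through x.
Removing C from such a failure leaves a splitting set of V \ C of size p + 1 - |C|. Conversely, a
splitting set of V \ C of size p, enlarged by x, is a target that is not reached, since without x it
misses C. Thus `hrec` says that failures are no more numerous than unreached targets. -/
lemma card_splitting_mem_le (h𝒞 : (𝒞 : Set (Finset ι)).PairwiseDisjoint id)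
    (h2 : ∀ C ∈ 𝒞, 2 ≤ C.card) {p : ℕ} {x : ι} (hxV : x ∈ V)
    (hrec : ∀ C ∈ 𝒞, x ∈ C → C.card ≤ p + 1 →
      (splitting (V \ C) (𝒞.erase C) (p + 1 - C.card)).card ≤
        (splitting (V \ C) (𝒞.erase C) p).card) :
    ((splitting V 𝒞 p).filter fun b => x ∉ b).card ≤
      ((splitting V 𝒞 (p + 1)).filter fun a => x ∈ a).card := by
  classical
  set A := (splitting V 𝒞 p).filter fun b => x ∉ b with hA
  set B := (splitting V 𝒞 (p + 1)).filter fun a => x ∈ a with hB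
  have hinj : Set.InjOn (insert x) (A : Set (Finset ι)) := by
    intro a ha b hb hab
    simp only [hA, Finset.coe_filter, Set.mem_ofPred_eq] at ha hb
    rw [← Finset.erase_insert ha.2, ← Finset.erase_insert hb.2, hab]
  rw [← Finset.card_image_of_injOn hinj]
  set A' := A.image (insert x) with hA'
  have hmemA' : ∀ a, a ∈ A' ↔ x ∈ a ∧ a.erase x ∈ splitting V 𝒞 p := by
    intro a
    simp only [hA', hA, Finset.mem_image, Finset.mem_filter]
    constructor
    · rintro ⟨b, ⟨hb, hxb⟩, rfl⟩
      exact ⟨Finset.mem_insert_self _ _, by rwa [Finset.erase_insert hxb]⟩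
    · rintro ⟨hx, ha⟩
      exact ⟨a.erase x, ⟨ha, Finset.notMem_erase _ _⟩, Finset.insert_erase hx⟩
  rw [← Finset.card_sdiff_le_card_sdiff_iff]
  have hbad : ∀ a ∈ A' \ B, ∃ C ∈ 𝒞, x ∈ C ∧ C ⊆ a := by
    intro a ha
    rw [Finset.mem_sdiff, hmemA', hB, Finset.mem_filter, mem_splitting, mem_splitting] at ha
    obtain ⟨⟨hxa, ⟨haV, hac⟩, hsp⟩, hn⟩ := ha
    by_contra! hcon
    refine hn ⟨⟨⟨?_, ?_⟩, fun C hC => ⟨fun hCa => ?_, fun hd => ?_⟩⟩, hxa⟩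
    · rw [← Finset.insert_erase hxa]
      exact Finset.insert_subset hxV haV
    · rw [Finset.card_erase_of_mem hxa] at hac
      have := Finset.card_pos.2 ⟨x, hxa⟩
      omega
    · by_cases hxC : x ∈ C
      · exact hcon C hC hxC hCa
      · exact (hsp C hC).1 (Finset.subset_erase.2 ⟨hCa, hxC⟩)
    · exact (hsp C hC).2 (Finset.disjoint_of_subset_right (Finset.erase_subset _ _) hd)
  rcases (A' \ B).eq_empty_or_nonempty with he | ⟨a₀, ha₀⟩
  · simp [he]
  obtain ⟨C, hC, hxC, hCa₀⟩ := hbad a₀ ha₀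
  have huniq : ∀ D ∈ 𝒞, x ∈ D → D = C := by
    intro D hD hxD
    by_contra hne
    exact Finset.disjoint_left.1 (h𝒞 hD hC hne) hxD hxC
  have hle : C.card ≤ p + 1 := by
    have h1 := Finset.card_le_card hCa₀
    rw [Finset.mem_sdiff, hmemA', mem_splitting] at ha₀
    have h3 := ha₀.1.2.1.2
    rw [Finset.card_erase_of_mem ha₀.1.1] at h3
    omega
  refine le_trans ?_ ((hrec C hC hxC hle).trans ?_)
  · refine Finset.card_le_card_of_injOn (fun a => a \ C) ?_ ?_
    · intro a ha
      have hCa : C ⊆ a := by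
        obtain ⟨D, hD, hxD, hDa⟩ := hbad a ha
        rwa [huniq D hD hxD] at hDa
      have ha' := ha
      rw [Finset.mem_coe, Finset.mem_sdiff, hmemA', mem_splitting] at ha'
      obtain ⟨⟨hxa, ⟨haV, hac⟩, hsp⟩, -⟩ := ha'
      rw [Finset.mem_coe, mem_splitting]
      refine ⟨⟨Finset.sdiff_subset_sdiff ?_ le_rfl, ?_⟩, fun D hD => ⟨fun hDa => ?_, fun hd => ?_⟩⟩
      · rw [← Finset.insert_erase hxa]
        exact Finset.insert_subset hxV haV
      · rw [Finset.card_sdiff_of_subset hCa]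
        rw [Finset.card_erase_of_mem hxa] at hac
        have := Finset.card_pos.2 ⟨x, hxa⟩
        omega
      · refine (hsp D (Finset.mem_of_mem_erase hD)).1 (Finset.subset_erase.2 ⟨?_, fun hxD => ?_⟩)
        · exact hDa.trans Finset.sdiff_subset
        · exact Finset.ne_of_mem_erase hD (huniq D (Finset.mem_of_mem_erase hD) hxD)
      · refine (hsp D (Finset.mem_of_mem_erase hD)).2 (Finset.disjoint_left.2 fun y hy hya => ?_)
        have hyC : y ∉ C := Finset.disjoint_left.1
          (h𝒞 (Finset.mem_of_mem_erase hD) hC (Finset.ne_of_mem_erase hD)) hy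
        exact Finset.disjoint_left.1 hd hy
          (Finset.mem_sdiff.2 ⟨Finset.mem_of_mem_erase hya, hyC⟩)
    · intro a ha b hb hab
      have hsub : ∀ a ∈ A' \ B, C ⊆ a := by
        intro a ha
        obtain ⟨D, hD, hxD, hDa⟩ := hbad a ha
        rwa [huniq D hD hxD] at hDa
      rw [← Finset.sdiff_union_of_subset (hsub a ha), ← Finset.sdiff_union_of_subset (hsub b hb)]
      exact congrArg (· ∪ C) hab
  · refine Finset.card_le_card_of_injOn (insert x) ?_ ?_
    · intro d hd
      rw [Finset.mem_coe, mem_splitting] at hd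
      obtain ⟨⟨hdV, hdc⟩, hsp⟩ := hd
      have hCd : Disjoint C d :=
        (Finset.disjoint_of_subset_left hdV Finset.sdiff_disjoint).symm
      have hxd : x ∉ d := Finset.disjoint_left.1 hCd hxC
      rw [Finset.mem_coe, Finset.mem_sdiff, hmemA', hB, Finset.mem_filter, mem_splitting,
        mem_splitting, Finset.erase_insert hxd]
      refine ⟨⟨⟨⟨Finset.insert_subset hxV (hdV.trans Finset.sdiff_subset), ?_⟩, fun D hD => ?_⟩,
        Finset.mem_insert_self _ _⟩, fun h => (h.2.2 C hC).2 hCd⟩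
      · rw [Finset.card_insert_of_notMem hxd, hdc]
      by_cases hDC : D = C
      · subst hDC
        refine ⟨fun hsub => ?_, fun hdis => ?_⟩
        · have : D ⊆ {x} := by
            intro y hy
            rcases Finset.mem_insert.1 (hsub hy) with h | h
            · simp [h]
            · exact absurd h (Finset.disjoint_left.1 hCd hy)
          have := Finset.card_le_card this
          have := h2 D hC
          simp at *
          omega
        · exact Finset.disjoint_left.1 hdis hxC (Finset.mem_insert_self _ _)
      · have hD' := hsp D (Finset.mem_erase.2 ⟨hDC, hD⟩)
        refine ⟨fun hsub => hD'.1 fun y hy => ?_, fun hdis => hD'.2 ?_⟩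
        · rcases Finset.mem_insert.1 (hsub hy) with h | h
          · subst h
            exact absurd (huniq D hD hy) hDC
          · exact h
        · exact Finset.disjoint_of_subset_right (Finset.subset_insert _ _) hdis
    · intro a ha b hb hab
      have hnot : ∀ d ∈ splitting (V \ C) (𝒞.erase C) p, x ∉ d := fun d hd hxd =>
        (Finset.mem_sdiff.1 ((mem_splitting.1 hd).1.1 hxd)).2 hxC
      rw [← Finset.erase_insert (hnot a ha), ← Finset.erase_insert (hnot b hb)]
      exact congrArg (fun s => Finset.erase s x) hab

/-- The number of `q`-element sets splitting a disjoint family, divided by the number of all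
`q`-element sets, does not decrease up to the middle. -/
theorem card_splitting_step (h𝒞 : (𝒞 : Set (Finset ι)).PairwiseDisjoint id)
    (hV : ∀ C ∈ 𝒞, C ⊆ V) (h1 : ∀ C ∈ 𝒞, C.Nonempty) {p : ℕ} (hp : 2 * p + 1 ≤ V.card) :
    (V.card - p) * (splitting V 𝒞 p).card ≤ (p + 1) * (splitting V 𝒞 (p + 1)).card := by
  induction hn : 𝒞.card using Nat.strong_induction_on generalizing 𝒞 V p with
  | _ n ih =>
  by_cases h2 : ∀ C ∈ 𝒞, 2 ≤ C.card
  swap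
  -- A singleton is contained in or disjoint from every set, so the left side vanishes.
  · push Not at h2
    obtain ⟨C, hC, hlt⟩ := h2
    obtain ⟨x, hx⟩ := h1 C hC
    have hCx : C = {x} := by
      refine Finset.eq_singleton_iff_unique_mem.2 ⟨hx, fun y hy => ?_⟩
      exact Finset.card_le_one.1 (by omega) y hy x hx
    have : splitting V 𝒞 p = ∅ := by
      refine Finset.eq_empty_of_forall_notMem fun a ha => ?_
      have := (mem_splitting.1 ha).2 C hC
      rw [hCx] at this
      simp at this
    simp [this]
  have hrec : ∀ x ∈ V, ((splitting V 𝒞 p).filter fun b => x ∉ b).card ≤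
      ((splitting V 𝒞 (p + 1)).filter fun a => x ∈ a).card := by
    intro x hx
    refine card_splitting_mem_le h𝒞 h2 hx fun C hC hxC hle => ?_
    have hsub : ∀ D ∈ 𝒞.erase C, D ⊆ V \ C := fun D hD =>
      Finset.subset_sdiff.2 ⟨hV D (Finset.mem_of_mem_erase hD),
        h𝒞 (Finset.mem_of_mem_erase hD) hC (Finset.ne_of_mem_erase hD)⟩
    have hcard : (V \ C).card = V.card - C.card := Finset.card_sdiff_of_subset (hV C hC)
    have hCV := Finset.card_le_card (hV C hC)
    have hC2 := h2 C hC
    -- The sizes p + 1 - |C| and p add up to at most |V \ C| because 2p + 1 ≤ |V|.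
    refine le_of_symm_of_step (N := (V \ C).card)
      (M := fun q => (splitting (V \ C) (𝒞.erase C) q).card)
      (fun p q h => card_splitting_symm hsub h) ?_ (by omega) (by omega)
    intro r hr
    have := ih (𝒞.erase C).card (by rw [← hn]; exact Finset.card_erase_lt_of_mem hC)
      (h𝒞.subset (by simp)) hsub
      (fun D hD => h1 D (Finset.mem_of_mem_erase hD)) hr rfl
    have h3 : r + 1 ≤ (V \ C).card - r := by omega
    exact Nat.le_of_mul_le_mul_left ((Nat.mul_le_mul_right _ h3).trans this) (by omega)
  -- Double counting: pairs of a p-set and a point outside it, against pairs of a (p + 1)-set and a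
  -- point inside it.
  have hL : (V.card - p) * (splitting V 𝒞 p).card =
      ∑ x ∈ V, ((splitting V 𝒞 p).filter fun b => x ∉ b).card := by
    have := Finset.sum_card_bipartiteAbove_eq_sum_card_bipartiteBelow (s := splitting V 𝒞 p)
      (t := V) (fun b x => x ∉ b)
    simp only [Finset.bipartiteAbove, Finset.bipartiteBelow] at this
    rw [← this, mul_comm, ← smul_eq_mul, ← Finset.sum_const]
    refine Finset.sum_congr rfl fun b hb => ?_
    obtain ⟨⟨hbV, hbc⟩, -⟩ := mem_splitting.1 hb
    rw [Finset.filter_notMem_eq_sdiff, Finset.card_sdiff_of_subset hbV, hbc]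
  have hR : (p + 1) * (splitting V 𝒞 (p + 1)).card =
      ∑ x ∈ V, ((splitting V 𝒞 (p + 1)).filter fun b => x ∈ b).card := by
    have := Finset.sum_card_bipartiteAbove_eq_sum_card_bipartiteBelow (s := splitting V 𝒞 (p + 1))
      (t := V) (fun b x => x ∈ b)
    simp only [Finset.bipartiteAbove, Finset.bipartiteBelow] at this
    rw [← this, mul_comm, ← smul_eq_mul, ← Finset.sum_const]
    refine Finset.sum_congr rfl fun b hb => ?_
    obtain ⟨⟨hbV, hbc⟩, -⟩ := mem_splitting.1 hb
    rw [Finset.filter_mem_eq_inter, Finset.inter_eq_right.2 hbV, hbc]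
  rw [hL, hR]
  exact Finset.sum_le_sum hrec

end Splitting

/-! ### Principal minors and their multilinearity in the rows -/

section Minors

variable {ι : Type*} [DecidableEq ι]

/-- The principal minor of a matrix over an arbitrary finite index type. -/
noncomputable def pminor (S : Matrix ι ι ℝ) (a : Finset ι) : ℝ :=
  (S.submatrix (Subtype.val : a → ι) (Subtype.val : a → ι)).det

lemma pminor_congr {S T : Matrix ι ι ℝ} {a : Finset ι} (h : ∀ i ∈ a, ∀ j ∈ a, S i j = T i j) :
    pminor S a = pminor T a := by
  unfold pminor
  congr 1
  ext i j
  exact h i i.2 j j.2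

@[simp] lemma pminor_empty (S : Matrix ι ι ℝ) : pminor S ∅ = 1 := by
  simp [pminor]

variable [Fintype ι]

lemma pminor_eq_det (S : Matrix ι ι ℝ) (a : Finset ι) :
    pminor S a = (Matrix.of fun i j => if i ∈ a then S i j else (1 : Matrix ι ι ℝ) i j).det := by
  rw [pminor, ← Matrix.det_piecewise_one_eq_submatrix_det]
  congr 1
  ext i j
  by_cases h : i ∈ a <;> simp [h, Matrix.row, Finset.piecewise]

lemma pminor_erase_of_row {S : Matrix ι ι ℝ} {a : Finset ι} {i : ι}
    (h : ∀ j ∈ a, S i j = (1 : Matrix ι ι ℝ) i j) : pminor S a = pminor S (a.erase i) := by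
  have : pminor S a =
      pminor (Matrix.of fun k j => if k = i then (1 : Matrix ι ι ℝ) k j else S k j) a := by
    refine pminor_congr fun k _ j hj => ?_
    by_cases hk : k = i
    · subst hk
      simp [h j hj]
    · simp [hk]
  rw [this, pminor_eq_det, pminor_eq_det]
  congr 1
  ext k j
  by_cases hk : k = i <;> simp [hk]

/-- Zeroing the entries between a and its complement leaves a block diagonal matrix. As a single
determinant, the product is multilinear in full rows. -/
lemma pminor_mul_pminor_compl (S : Matrix ι ι ℝ) (a : Finset ι) :
    pminor S a * pminor S aᶜ =
      (Matrix.of fun i j => if (i ∈ a ↔ j ∈ a) then S i j else 0).det := by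
  rw [Matrix.twoBlockTriangular_det _ (fun i => i ∈ a) (by
    intro i hi j hj
    simp [hi, hj])]
  have hl : pminor S a = (Matrix.toSquareBlockProp
      (Matrix.of fun i j => if (i ∈ a ↔ j ∈ a) then S i j else 0) fun i => i ∈ a).det := by
    let e : {i // i ∈ a} ≃ a := Equiv.refl _
    rw [pminor, ← Matrix.det_submatrix_equiv_self e]
    refine congrArg Matrix.det ?_
    ext i j
    have hi := i.2
    have hj := j.2
    simp [Matrix.toSquareBlockProp, hi, hj, e]
  have hr : pminor S aᶜ = (Matrix.toSquareBlockProp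
      (Matrix.of fun i j => if (i ∈ a ↔ j ∈ a) then S i j else 0) fun i => ¬ i ∈ a).det := by
    let e : {i // ¬ i ∈ a} ≃ (aᶜ : Finset ι) := Equiv.subtypeEquivRight (by simp)
    rw [pminor, ← Matrix.det_submatrix_equiv_self e]
    refine congrArg Matrix.det ?_
    ext i j
    have hi := i.2
    have hj := j.2
    simp [Matrix.toSquareBlockProp, hi, hj, e]
  rw [hl, hr]
  congr!

/-- The product of two complementary principal minors, as a multilinear function of the rows. -/
noncomputable def complMinorsMultilinear (a : Finset ι) :
    MultilinearMap ℝ (fun _ : ι => ι → ℝ) ℝ :=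
  (Matrix.detRowAlternating (n := ι) (R := ℝ)).toMultilinearMap.compLinearMap fun i =>
    LinearMap.pi fun j => if (i ∈ a ↔ j ∈ a) then LinearMap.proj j else 0

lemma complMinorsMultilinear_apply (S : Matrix ι ι ℝ) (a : Finset ι) :
    complMinorsMultilinear a (fun i => S i) = pminor S a * pminor S aᶜ := by
  rw [pminor_mul_pminor_compl]
  change Matrix.det _ = Matrix.det _
  congr 1
  ext i j
  simp only [LinearMap.pi_apply, Matrix.of_apply]
  split_ifs <;> simp

end Minors

/-! ### Minors of the matrix of a partial function -/

section FunctionalGraph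

variable {ι : Type*} [Fintype ι] [DecidableEq ι]

/-- The identity matrix minus the adjacency matrix of a partial function. -/
def funMatrix (g : ι → Option ι) : Matrix ι ι ℝ :=
  Matrix.of fun i j => (1 : Matrix ι ι ℝ) i j - if g i = some j then 1 else 0

/-- `g` is defined on `C` and maps `C` to itself. -/
def IsInvariant (g : ι → Option ι) (C : Finset ι) : Prop :=
  ∀ i ∈ C, ∃ j ∈ C, g i = some j

open Classical in
/-- The minimal nonempty invariant sets: the vertex sets of the cycles of `g`. -/
noncomputable def cycleSets (g : ι → Option ι) : Finset (Finset ι) :=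
  Finset.univ.filter fun C => C.Nonempty ∧ IsInvariant g C ∧
    ∀ D ⊆ C, D.Nonempty → IsInvariant g D → D = C

lemma mem_cycleSets {g : ι → Option ι} {C : Finset ι} :
    C ∈ cycleSets g ↔ C.Nonempty ∧ IsInvariant g C ∧
      ∀ D ⊆ C, D.Nonempty → IsInvariant g D → D = C := by
  simp [cycleSets]

lemma exists_mem_cycleSets_subset {g : ι → Option ι} {a : Finset ι} (h0 : a.Nonempty)
    (h : IsInvariant g a) : ∃ C ∈ cycleSets g, C ⊆ a := by
  induction a using Finset.strongInduction with
  | H a ih =>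
    by_cases hmin : ∀ D ⊆ a, D.Nonempty → IsInvariant g D → D = a
    · exact ⟨a, mem_cycleSets.2 ⟨h0, h, hmin⟩, le_rfl⟩
    · push Not at hmin
      obtain ⟨D, hDa, hD0, hD, hne⟩ := hmin
      obtain ⟨C, hC, hCD⟩ := ih D (Finset.ssubset_iff_subset_ne.2 ⟨hDa, hne⟩) hD0 hD
      exact ⟨C, hC, hCD.trans hDa⟩

lemma pairwiseDisjoint_cycleSets (g : ι → Option ι) :
    (cycleSets g : Set (Finset ι)).PairwiseDisjoint id := by
  intro C hC D hD hne
  obtain ⟨-, hCi, hCm⟩ := mem_cycleSets.1 hC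
  obtain ⟨-, hDi, hDm⟩ := mem_cycleSets.1 hD
  by_contra hdis
  have hn : (C ∩ D).Nonempty := Finset.not_disjoint_iff_nonempty_inter.1 hdis
  have hi : IsInvariant g (C ∩ D) := by
    intro i hi
    obtain ⟨j, hj, hgj⟩ := hCi i (Finset.mem_inter.1 hi).1
    obtain ⟨k, hk, hgk⟩ := hDi i (Finset.mem_inter.1 hi).2
    rw [hgj, Option.some_inj] at hgk
    subst hgk
    exact ⟨j, Finset.mem_inter.2 ⟨hj, hk⟩, hgj⟩
  exact hne ((hCm _ Finset.inter_subset_left hn hi).symm.trans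
    (hDm _ Finset.inter_subset_right hn hi))

/-- The indicator of the union of all invariant subsets of a is a kernel vector: a point i of a lies
in the union exactly when g i is defined and lies in it. -/
lemma pminor_funMatrix_eq_zero {g : ι → Option ι} {a C : Finset ι} (h0 : C.Nonempty)
    (hC : IsInvariant g C) (hCa : C ⊆ a) : pminor (funMatrix g) a = 0 := by
  classical
  rw [pminor_eq_det]
  refine Matrix.exists_mulVec_eq_zero_iff.1
    ⟨fun i => if ∃ D ⊆ a, IsInvariant g D ∧ i ∈ D then 1 else 0, ?_, ?_⟩
  · obtain ⟨i, hi⟩ := h0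
    intro h
    have := congrFun h i
    simp only [Pi.zero_apply, ite_eq_right_iff, one_ne_zero, imp_false] at this
    exact this ⟨C, hCa, hC, hi⟩
  · ext i
    simp only [Matrix.mulVec, dotProduct, Matrix.of_apply, Pi.zero_apply]
    by_cases hi : i ∈ a
    · simp only [hi, if_true, funMatrix, Matrix.of_apply, sub_mul, Finset.sum_sub_distrib,
        Matrix.one_apply, ite_mul, one_mul, zero_mul, Finset.sum_ite_eq, Finset.mem_univ]
      rcases hg : g i with _ | j
      · have : ¬ ∃ D ⊆ a, IsInvariant g D ∧ i ∈ D := by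
          rintro ⟨D, -, hD, hiD⟩
          obtain ⟨j, -, hj⟩ := hD i hiD
          simp [hg] at hj
        simp [this]
      · have : (∃ D ⊆ a, IsInvariant g D ∧ i ∈ D) ↔ ∃ D ⊆ a, IsInvariant g D ∧ j ∈ D := by
          constructor
          · rintro ⟨D, hDa, hD, hiD⟩
            obtain ⟨k, hk, hgk⟩ := hD i hiD
            rw [hg, Option.some_inj] at hgk
            exact ⟨D, hDa, hD, hgk ▸ hk⟩
          · rintro ⟨D, hDa, hD, hjD⟩
            refine ⟨insert i D, Finset.insert_subset hi hDa, fun k hk => ?_,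
              Finset.mem_insert_self _ _⟩
            rcases Finset.mem_insert.1 hk with rfl | hk
            · exact ⟨j, Finset.mem_insert_of_mem hjD, hg⟩
            · obtain ⟨l, hl, hgl⟩ := hD k hk
              exact ⟨l, Finset.mem_insert_of_mem hl, hgl⟩
        simp [this]
    · have : ¬ ∃ D ⊆ a, IsInvariant g D ∧ i ∈ D := by
        rintro ⟨D, hDa, -, hiD⟩
        exact hi (hDa hiD)
      have hz : ∀ x, (if i = x then (1 : ℝ) else 0) *
          (if ∃ D ⊆ a, IsInvariant g D ∧ x ∈ D then 1 else 0) = 0 := by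
        intro x
        by_cases hx : i = x
        · subst hx
          simp [this]
        · simp [hx]
      simp only [hi, if_false, Matrix.one_apply, hz, Finset.sum_const_zero]

/-- Some i in a has no image in a, so its row restricted to a is a unit row and i can be deleted. -/
lemma pminor_funMatrix_eq_one {g : ι → Option ι} {a : Finset ι}
    (h : ∀ C ⊆ a, C.Nonempty → ¬ IsInvariant g C) : pminor (funMatrix g) a = 1 := by
  induction a using Finset.strongInduction with
  | H a ih =>
    rcases a.eq_empty_or_nonempty with rfl | h0
    · simp
    have hn := h a le_rfl h0
    unfold IsInvariant at hn
    push Not at hn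
    obtain ⟨i, hi, hg⟩ := hn
    rw [pminor_erase_of_row (i := i) fun j hj => by simp [funMatrix, hg j hj]]
    exact ih _ (Finset.erase_ssubset hi) fun C hC => h C (hC.trans (Finset.erase_subset _ _))

lemma pminor_funMatrix_mul_compl (g : ι → Option ι) (a : Finset ι) :
    pminor (funMatrix g) a * pminor (funMatrix g) aᶜ =
      if ∀ C ∈ cycleSets g, ¬ C ⊆ a ∧ ¬ Disjoint C a then 1 else 0 := by
  have hone : ∀ b : Finset ι, (∀ C ∈ cycleSets g, ¬ C ⊆ b) → pminor (funMatrix g) b = 1 := by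
    intro b hb
    refine pminor_funMatrix_eq_one fun C hC h0 hi => ?_
    obtain ⟨D, hD, hDC⟩ := exists_mem_cycleSets_subset h0 hi
    exact hb D hD (hDC.trans hC)
  have hcompl : ∀ C : Finset ι, C ⊆ aᶜ ↔ Disjoint C a := fun C =>
    Finset.subset_compl_iff_disjoint_right
  split_ifs with h
  · rw [hone a fun C hC => (h C hC).1, hone aᶜ fun C hC => by rw [hcompl]; exact (h C hC).2,
      one_mul]
  · push Not at h
    obtain ⟨C, hC, hd⟩ := h
    obtain ⟨h0, hi, -⟩ := mem_cycleSets.1 hC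
    by_cases hCa : C ⊆ a
    · rw [pminor_funMatrix_eq_zero h0 hi hCa, zero_mul]
    · rw [pminor_funMatrix_eq_zero h0 hi ((hcompl C).2 (hd hCa)), mul_zero]

end FunctionalGraph

/-! ### Products of complementary minors -/

section Complementary

variable {ι : Type*} [Fintype ι] [DecidableEq ι]

lemma multilinear_nonneg_of_rows (F : MultilinearMap ℝ (fun _ : ι => ι → ℝ) ℝ)
    {κ : Type*} [Fintype κ] (w : ι → κ → ℝ) (r : ι → κ → ι → ℝ)
    (hw : ∀ i o, 0 ≤ w i o)
    (hF : ∀ g : ι → κ, (∀ i, w i (g i) ≠ 0) → 0 ≤ F fun i => r i (g i)) :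
    0 ≤ F fun i => ∑ o, w i o • r i o := by
  rw [MultilinearMap.map_sum]
  refine Finset.sum_nonneg fun g _ => ?_
  rw [MultilinearMap.map_smul_univ, smul_eq_mul]
  by_cases h : ∀ i, w i (g i) ≠ 0
  · exact mul_nonneg (Finset.prod_nonneg fun i _ => hw i _) (hF g h)
  · push Not at h
    obtain ⟨i, hi⟩ := h
    rw [Finset.prod_eq_zero (Finset.mem_univ i) hi, zero_mul]

/-- Sum of the products of complementary principal minors of the block on `η`, the first of
size `p`. -/
noncomputable def complSum (S : Matrix ι ι ℝ) (η : Finset ι) (p : ℕ) : ℝ :=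
  ∑ a ∈ η.powersetCard p, pminor S a * pminor S (η \ a)

lemma complSum_funMatrix {g : ι → Option ι} (η : Finset ι) (p : ℕ) :
    ∑ a ∈ η.powersetCard p, pminor (funMatrix g) a * pminor (funMatrix g) aᶜ =
      (splitting η (cycleSets g) p).card := by
  simp only [pminor_funMatrix_mul_compl]
  rw [Finset.sum_ite, Finset.sum_const_zero, add_zero, Finset.sum_const, nsmul_one, splitting]
  congr!

lemma complSum_step_of_rowSum_nonneg {S : Matrix ι ι ℝ} {η : Finset ι}
    (hoff : ∀ i ∈ η, ∀ j ∈ η, i ≠ j → S i j ≤ 0) (hrow : ∀ i ∈ η, 0 ≤ ∑ j ∈ η, S i j)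
    {p : ℕ} (hp : 2 * p + 1 ≤ η.card) :
    ((η.card : ℝ) - p) * complSum S η p ≤ (p + 1) * complSum S η (p + 1) := by
  let F : MultilinearMap ℝ (fun _ : ι => ι → ℝ) ℝ :=
    ((p : ℝ) + 1) • (∑ a ∈ η.powersetCard (p + 1), complMinorsMultilinear a) -
      ((η.card : ℝ) - p) • (∑ a ∈ η.powersetCard p, complMinorsMultilinear a)
  have hF : ∀ T : Matrix ι ι ℝ, F (fun i => T i) =
      (p + 1) * (∑ a ∈ η.powersetCard (p + 1), pminor T a * pminor T aᶜ) -
        ((η.card : ℝ) - p) * ∑ a ∈ η.powersetCard p, pminor T a * pminor T aᶜ := by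
    intro T
    simp only [F, sub_apply, smul_apply, sum_apply,
      complMinorsMultilinear_apply, smul_eq_mul]
  -- Identity rows outside η make the minors on aᶜ and on η \ a agree.
  let T : Matrix ι ι ℝ := Matrix.of fun i j =>
    if i ∈ η then (if j ∈ η then S i j else 0) else (1 : Matrix ι ι ℝ) i j
  -- `none` stands for the row e_i, weighted by the row sum, and `some j` for e_i - e_j, weighted by
  -- -S i j. Outside η only `none` has nonzero weight, which confines the cycles to η.
  let w : ι → Option ι → ℝ := fun i o =>
    if i ∈ η then o.elim (∑ j ∈ η, S i j) (fun j => if j ∈ η ∧ i ≠ j then - S i j else 0)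
    else o.elim 1 (fun _ => 0)
  let r : ι → Option ι → ι → ℝ := fun i o j =>
    (1 : Matrix ι ι ℝ) i j - if o = some j then 1 else 0
  have hTr : (fun i => T i) = fun i => ∑ o, w i o • r i o := by
    funext i j
    rw [Fintype.sum_option]
    simp only [Finset.sum_apply, Pi.add_apply, Pi.smul_apply, smul_eq_mul, r, w, T,
      Matrix.of_apply, Option.elim, Option.some_inj, reduceCtorEq, if_false, sub_zero]
    by_cases hi : i ∈ η
    · simp only [hi, if_true, mul_sub, Finset.sum_sub_distrib, mul_ite, mul_one, mul_zero,
        Finset.sum_ite_eq', Finset.mem_univ, ← Finset.sum_mul]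
      have hsum : ∑ k, (if k ∈ η ∧ i ≠ k then - S i k else 0) = S i i - ∑ k ∈ η, S i k := by
        rw [← Finset.sum_filter, Finset.sum_neg_distrib, ← Finset.add_sum_erase η _ hi]
        have : Finset.univ.filter (fun k => k ∈ η ∧ i ≠ k) = η.erase i := by
          ext k
          simp [and_comm, eq_comm]
        rw [this]
        ring
      rw [hsum]
      by_cases hij : i = j
      · subst hij
        simp [hi]
      · by_cases hj : j ∈ η <;> simp [hij, hj]
    · simp [hi]
  have hpos : 0 ≤ F fun i => T i := by
    rw [hTr]
    refine multilinear_nonneg_of_rows F w r ?_ ?_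
    · intro i o
      by_cases hi : i ∈ η
      · rcases o with _ | j
        · simpa [w, hi] using hrow i hi
        · simp only [w, hi, if_true, Option.elim]
          split_ifs with h
          · have := hoff i hi j h.1 h.2
            linarith
          · exact le_rfl
      · rcases o with _ | j <;> simp [w, hi]
    · intro g hg
      have hout : ∀ i, i ∉ η → g i = none := by
        intro i hi
        have := hg i
        rcases h : g i with _ | j
        · rfl
        · simp [w, hi, h] at this
      have := hF (funMatrix g)
      change 0 ≤ F fun i => funMatrix g i
      rw [this, complSum_funMatrix, complSum_funMatrix, sub_nonneg]
      have hle := card_splitting_step (pairwiseDisjoint_cycleSets g) (V := η)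
        (fun C hC i hi => by
          by_contra hn
          obtain ⟨j, -, hj⟩ := (mem_cycleSets.1 hC).2.1 i hi
          simp [hout i hn] at hj)
        (fun C hC => (mem_cycleSets.1 hC).1) hp
      have : ((η.card - p : ℕ) : ℝ) = (η.card : ℝ) - p := by
        rw [Nat.cast_sub (by omega)]
      rw [← this]
      exact_mod_cast hle
  have hT : ∀ q, ∑ a ∈ η.powersetCard q, pminor T a * pminor T aᶜ = complSum S η q := by
    intro q
    refine Finset.sum_congr rfl fun a ha => ?_
    have haη := (Finset.mem_powersetCard.1 ha).1
    have h1 : pminor T a = pminor S a := pminor_congr fun i hi j hj => by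
      simp [T, haη hi, haη hj]
    have h2 : pminor T aᶜ = pminor T (η \ a) := by
      rw [pminor_eq_det, pminor_eq_det]
      congr 1
      ext i j
      by_cases hi : i ∈ η <;> by_cases hia : i ∈ a <;> simp [T, hi, hia]
    have h3 : pminor T (η \ a) = pminor S (η \ a) := pminor_congr fun i hi j hj => by
      simp [T, (Finset.mem_sdiff.1 hi).1, (Finset.mem_sdiff.1 hj).1]
    rw [h1, h2, h3]
  rw [hF, hT, hT] at hpos
  linarith

end Complementary

/-! ### Schur complements and semipositivity -/

section Elimination

variable {ι : Type*}

/-- The Schur complement with respect to the `i`-th diagonal entry, on the same index type. -/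
noncomputable def schur (S : Matrix ι ι ℝ) (i : ι) : Matrix ι ι ℝ :=
  Matrix.of fun k l => S k l - S k i / S i i * S i l

/-- On the block `η` the off-diagonal entries are nonpositive and some positive vector has a
positive image: the block is a nonsingular M-matrix. -/
def IsSemipositiveZ (S : Matrix ι ι ℝ) (η : Finset ι) : Prop :=
  (∀ i ∈ η, ∀ j ∈ η, i ≠ j → S i j ≤ 0) ∧
    ∃ x : ι → ℝ, (∀ i ∈ η, 0 < x i) ∧ ∀ i ∈ η, 0 < ∑ j ∈ η, S i j * x j

lemma sum_schur_mul (S : Matrix ι ι ℝ) (i k : ι) (η : Finset ι) (x : ι → ℝ) :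
    ∑ l ∈ η, schur S i k l * x l =
      ∑ l ∈ η, S k l * x l - S k i / S i i * ∑ l ∈ η, S i l * x l := by
  rw [Finset.mul_sum, ← Finset.sum_sub_distrib]
  refine Finset.sum_congr rfl fun l _ => ?_
  simp only [schur, Matrix.of_apply]
  ring

variable [DecidableEq ι]

lemma pminor_singleton (S : Matrix ι ι ℝ) (i : ι) : pminor S {i} = S i i := by
  simp [pminor, Matrix.det_unique]

lemma pminor_mul_cols (S : Matrix ι ι ℝ) (x : ι → ℝ) (a : Finset ι) :
    pminor (Matrix.of fun i j => S i j * x j) a = (∏ i ∈ a, x i) * pminor S a := by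
  have := Matrix.det_mul_row (fun i : a => x i) (S.submatrix (Subtype.val : a → ι) Subtype.val)
  rw [← Finset.prod_coe_sort a, pminor, pminor, ← this]
  congr 1
  ext i j
  simp [mul_comm]

lemma IsSemipositiveZ.diag_pos {S : Matrix ι ι ℝ} {η : Finset ι} (h : IsSemipositiveZ S η)
    {i : ι} (hi : i ∈ η) : 0 < S i i := by
  obtain ⟨hz, x, hx, hS⟩ := h
  have h1 := hS i hi
  rw [← Finset.add_sum_erase _ _ hi] at h1
  have h2 : ∑ j ∈ η.erase i, S i j * x j ≤ 0 := Finset.sum_nonpos fun j hj =>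
    mul_nonpos_of_nonpos_of_nonneg
      (hz i hi j (Finset.mem_of_mem_erase hj) (Finset.ne_of_mem_erase hj).symm)
      (hx j (Finset.mem_of_mem_erase hj)).le
  exact pos_of_mul_pos_left (by linarith) (hx i hi).le

lemma IsSemipositiveZ.mono {S : Matrix ι ι ℝ} {η θ : Finset ι} (h : IsSemipositiveZ S η)
    (hθ : θ ⊆ η) : IsSemipositiveZ S θ := by
  obtain ⟨hz, x, hx, hS⟩ := h
  refine ⟨fun i hi j hj => hz i (hθ hi) j (hθ hj), x, fun i hi => hx i (hθ hi), fun i hi => ?_⟩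
  have h1 := hS i (hθ hi)
  rw [← Finset.sum_sdiff hθ] at h1
  have h2 : ∑ j ∈ η \ θ, S i j * x j ≤ 0 := Finset.sum_nonpos fun j hj => by
    obtain ⟨hj, hjθ⟩ := Finset.mem_sdiff.1 hj
    exact mul_nonpos_of_nonpos_of_nonneg
      (hz i (hθ hi) j hj (ne_of_mem_of_not_mem hi hjθ)) (hx j hj).le
  linarith

lemma schur_offDiag_nonpos {S : Matrix ι ι ℝ} {i : ι} {η : Finset ι} (hi : i ∉ η)
    (hz : ∀ k ∈ insert i η, ∀ l ∈ insert i η, k ≠ l → S k l ≤ 0) (hii : 0 < S i i) :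
    ∀ k ∈ η, ∀ l ∈ η, k ≠ l → schur S i k l ≤ 0 := by
  intro k hk l hl hkl
  have h1 := hz k (Finset.mem_insert_of_mem hk) l (Finset.mem_insert_of_mem hl) hkl
  have h2 := hz k (Finset.mem_insert_of_mem hk) i (Finset.mem_insert_self _ _)
    (by rintro rfl; exact hi hk)
  have h3 := hz i (Finset.mem_insert_self _ _) l (Finset.mem_insert_of_mem hl)
    (by rintro rfl; exact hi hl)
  have : 0 ≤ S k i / S i i * S i l :=
    mul_nonneg_of_nonpos_of_nonpos (div_nonpos_of_nonpos_of_nonneg h2 hii.le) h3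
  simp only [schur, Matrix.of_apply]
  linarith

/-- The same vector works: its image in row k gains -S k i / S i i ≥ 0 times the positive image in
row i. -/
lemma IsSemipositiveZ.schur {S : Matrix ι ι ℝ} {i : ι} {η : Finset ι} (hi : i ∉ η)
    (h : IsSemipositiveZ S (insert i η)) : IsSemipositiveZ (schur S i) η := by
  have hii := h.diag_pos (Finset.mem_insert_self i η)
  obtain ⟨hz, x, hx, hS⟩ := h
  refine ⟨schur_offDiag_nonpos hi hz hii, x, fun k hk => hx k (Finset.mem_insert_of_mem hk),
    fun k hk => ?_⟩
  have h1 := hS k (Finset.mem_insert_of_mem hk)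
  have h2 := hS i (Finset.mem_insert_self _ _)
  rw [Finset.sum_insert hi] at h1 h2
  have h3 := hz k (Finset.mem_insert_of_mem hk) i (Finset.mem_insert_self _ _)
    (by rintro rfl; exact hi hk)
  have h4 : S k i / S i i ≤ 0 := div_nonpos_of_nonpos_of_nonneg h3 hii.le
  rw [sum_schur_mul]
  have h5 : S k i / S i i * (S i i * x i + ∑ l ∈ η, S i l * x l) ≤ 0 :=
    mul_nonpos_of_nonpos_of_nonneg h4 h2.le
  have h6 : S k i / S i i * (S i i * x i) = S k i * x i := by
    field_simp
  rw [mul_add, h6] at h5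
  linarith

variable [Fintype ι]

/-- Row operations with row i produce the Schur complement and clear column i; column operations
then clear row i, leaving the pivot as a factor. -/
lemma pminor_insert {S : Matrix ι ι ℝ} {i : ι} (hi : S i i ≠ 0) {a : Finset ι} (ha : i ∉ a) :
    pminor S (insert i a) = S i i * pminor (schur S i) a := by
  rw [pminor_eq_det, pminor_eq_det]
  set T : Matrix ι ι ℝ := Matrix.of fun k l =>
    if k ∈ a then schur S i k l else (1 : Matrix ι ι ℝ) k l with hT
  have h1 : (Matrix.of fun k l =>
      if k ∈ insert i a then S k l else (1 : Matrix ι ι ℝ) k l).det =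
      (Matrix.of fun k l => if k = i then S i l else T k l).det := by
    refine Matrix.det_eq_of_forall_row_eq_smul_add_const
      (fun k => if k ∈ a then S k i / S i i else 0) i (by simp [ha]) fun k l => ?_
    by_cases hk : k = i
    · subst hk
      simp [ha]
    · by_cases hka : k ∈ a <;> simp [hk, hka, hT, schur]
  have h2 : (Matrix.of fun k l => if k = i then S i l else T k l).det =
      (Matrix.of fun k l => (if k = i then S i i else 1) * T k l).det := by
    rw [← Matrix.det_transpose,
      ← Matrix.det_transpose (Matrix.of fun k l => (if k = i then S i i else 1) * T k l)]
    refine Matrix.det_eq_of_forall_row_eq_smul_add_const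
      (fun l => if l = i then 0 else S i l / S i i) i (by simp) fun l k => ?_
    simp only [Matrix.transpose_apply, Matrix.of_apply]
    by_cases hk : k = i
    · subst hk
      by_cases hl : l = k
      · subst hl
        simp [hT, ha]
      · have hl' : k ≠ l := fun h => hl h.symm
        simp [hT, ha, hl, hl']
        field_simp
    · have : T k i = 0 := by
        by_cases hka : k ∈ a
        · simp [hT, hka, schur]
          field_simp
          ring
        · simp [hT, hka, hk]
      by_cases hl : l = i <;> simp [hk, hl, this]
  rw [h1, h2, Matrix.det_mul_column]
  congr 1
  simp [Finset.prod_ite_eq']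

/-- The Schur complement inherits positive minors by `pminor_insert`, and a positive vector for it
extends to one for S. -/
lemma isSemipositiveZ_of_pminor_pos {η : Finset ι} {S : Matrix ι ι ℝ}
    (hz : ∀ i ∈ η, ∀ j ∈ η, i ≠ j → S i j ≤ 0) (hp : ∀ a ⊆ η, 0 < pminor S a) :
    IsSemipositiveZ S η := by
  induction η using Finset.induction_on generalizing S with
  | empty => exact ⟨by simp, fun _ => 1, by simp, by simp⟩
  | insert i η hi ih =>
    have hii : 0 < S i i := by
      rw [← pminor_singleton S i]
      exact hp _ (by simp)
    obtain ⟨-, y, hy, hSy⟩ := ih (S := NewtonMMatrix.schur S i) (schur_offDiag_nonpos hi hz hii)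
      fun a ha => by
        have := hp (insert i a) (Finset.insert_subset_insert _ ha)
        rw [pminor_insert hii.ne' fun h => hi (ha h)] at this
        exact pos_of_mul_pos_right this hii.le
    have hev : ∀ᶠ ε : ℝ in nhdsWithin 0 (Set.Ioi 0), ∀ k ∈ η,
        0 < ∑ l ∈ η, NewtonMMatrix.schur S i k l * y l + S k i / S i i * ε := by
      rw [Filter.eventually_all_finset]
      intro k hk
      have hc : Continuous fun ε : ℝ =>
        ∑ l ∈ η, NewtonMMatrix.schur S i k l * y l + S k i / S i i * ε := by fun_prop
      refine Filter.Eventually.filter_mono nhdsWithin_le_nhds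
        (hc.continuousAt.eventually (lt_mem_nhds ?_))
      simpa using hSy k hk
    obtain ⟨ε, hε, hε0⟩ := (hev.and self_mem_nhdsWithin).exists
    have hε0 : 0 < ε := hε0
    have hsum : ∑ l ∈ η, S i l * y l ≤ 0 := Finset.sum_nonpos fun l hl =>
      mul_nonpos_of_nonpos_of_nonneg
        (hz i (Finset.mem_insert_self _ _) l (Finset.mem_insert_of_mem hl)
          (by rintro rfl; exact hi hl)) (hy l hl).le
    -- With this i-th coordinate the image in row i is ε, and in row k it is the Schur image plus S
    -- k i / S i i * ε, positive for small ε.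
    set z : ℝ := (ε - ∑ l ∈ η, S i l * y l) / S i i with hzdef
    have hz0 : 0 < z := div_pos (by linarith) hii
    have hupd : ∀ k, ∑ l ∈ η, S k l * Function.update y i z l = ∑ l ∈ η, S k l * y l := by
      intro k
      refine Finset.sum_congr rfl fun l hl => ?_
      rw [Function.update_of_ne (by rintro rfl; exact hi hl)]
    refine ⟨hz, Function.update y i z, ?_, ?_⟩
    · intro k hk
      rcases Finset.mem_insert.1 hk with rfl | hk
      · simpa using hz0
      · rw [Function.update_of_ne (ne_of_mem_of_not_mem hk hi)]
        exact hy k hk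
    · intro k hk
      rw [Finset.sum_insert hi, hupd, Function.update_self]
      rcases Finset.mem_insert.1 hk with rfl | hk
      · have : S k k * z = ε - ∑ l ∈ η, S k l * y l := by
          rw [hzdef]
          field_simp
        linarith
      · have h1 := hε k hk
        rw [sum_schur_mul] at h1
        have : S k i * z = S k i / S i i * ε - S k i / S i i * ∑ l ∈ η, S i l * y l := by
          rw [hzdef]
          field_simp
        linarith

/-- Scaling column j by x j makes the row sums positive and multiplies every product of
complementary minors by the same factor. -/
lemma complSum_step_of_isSemipositiveZ {S : Matrix ι ι ℝ} {η : Finset ι}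
    (h : IsSemipositiveZ S η) {p : ℕ} (hp : 2 * p + 1 ≤ η.card) :
    ((η.card : ℝ) - p) * complSum S η p ≤ (p + 1) * complSum S η (p + 1) := by
  obtain ⟨hz, x, hx, hS⟩ := h
  have key := complSum_step_of_rowSum_nonneg (S := Matrix.of fun i j => S i j * x j) (η := η)
    (fun i hi j hj hij => mul_nonpos_of_nonpos_of_nonneg (hz i hi j hj hij) (hx j hj).le)
    (fun i hi => (hS i hi).le) hp
  have hscale : ∀ q, complSum (Matrix.of fun i j => S i j * x j) η q =
      (∏ i ∈ η, x i) * complSum S η q := by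
    intro q
    rw [complSum, complSum, Finset.mul_sum]
    refine Finset.sum_congr rfl fun a ha => ?_
    rw [pminor_mul_cols, pminor_mul_cols,
      ← Finset.prod_sdiff (Finset.mem_powersetCard.1 ha).1]
    ring
  have hpos : 0 < ∏ i ∈ η, x i := Finset.prod_pos hx
  rw [hscale, hscale] at key
  refine le_of_mul_le_mul_left ?_ hpos
  linarith

/-- Averages of the products `A[γ ∪ a] A[γ ∪ (η \ a)]` over the `p`-element subsets `a` of `η`
do not decrease in `p` up to the middle. -/
theorem sum_pminor_union_step {γ η : Finset ι} (hd : Disjoint γ η) {S : Matrix ι ι ℝ}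
    (h : IsSemipositiveZ S (γ ∪ η)) {p : ℕ} (hp : 2 * p + 1 ≤ η.card) :
    ((η.card : ℝ) - p) *
        ∑ a ∈ η.powersetCard p, pminor S (γ ∪ a) * pminor S (γ ∪ (η \ a)) ≤
      (p + 1) * ∑ a ∈ η.powersetCard (p + 1), pminor S (γ ∪ a) * pminor S (γ ∪ (η \ a)) := by
  induction γ using Finset.induction_on generalizing S with
  | empty =>
    simp only [Finset.empty_union] at h ⊢
    exact complSum_step_of_isSemipositiveZ h hp
  | insert i γ hi ih =>
    rw [Finset.disjoint_insert_left] at hd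
    rw [Finset.insert_union] at h
    have hin : ∀ b ⊆ η, i ∉ γ ∪ b := fun b hb hib => by
      rcases Finset.mem_union.1 hib with h | h
      · exact hi h
      · exact hd.1 (hb h)
    have hii := h.diag_pos (Finset.mem_insert_self _ _)
    have key := ih hd.2 (h.schur (hin η le_rfl))
    have hsum : ∀ q, ∑ a ∈ η.powersetCard q,
        pminor S (insert i γ ∪ a) * pminor S (insert i γ ∪ (η \ a)) =
        S i i ^ 2 * ∑ a ∈ η.powersetCard q, pminor (schur S i) (γ ∪ a) *
          pminor (schur S i) (γ ∪ (η \ a)) := by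
      intro q
      rw [Finset.mul_sum]
      refine Finset.sum_congr rfl fun a ha => ?_
      rw [Finset.insert_union, Finset.insert_union,
        pminor_insert hii.ne' (hin a (Finset.mem_powersetCard.1 ha).1),
        pminor_insert hii.ne' (hin _ Finset.sdiff_subset)]
      ring
    rw [hsum, hsum]
    have := mul_le_mul_of_nonneg_left key (sq_nonneg (S i i))
    linarith

end Elimination

/-! ### The kernel 1 / (|α \ β| + 1) -/

lemma sum_choose_div_choose {i j : ℕ} (h : i ≤ j) :
    ∑ k ∈ Finset.range (i + 1), (i.choose k : ℝ) / (j.choose k : ℝ) =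
      ((j : ℝ) + 1) / ((j : ℝ) - i + 1) := by
  induction i generalizing j with
  | zero =>
    have : (j : ℝ) + 1 ≠ 0 := by positivity
    simp [div_self this]
  | succ i ih =>
    obtain ⟨j, rfl⟩ : ∃ j', j = j' + 1 := ⟨j - 1, by omega⟩
    have hij : i ≤ j := by omega
    rw [Finset.sum_range_succ']
    have hterm : ∀ k ∈ Finset.range (i + 1),
        (((i + 1).choose (k + 1) : ℕ) : ℝ) / (((j + 1).choose (k + 1) : ℕ) : ℝ) =
          ((i : ℝ) + 1) / ((j : ℝ) + 1) * ((i.choose k : ℝ) / (j.choose k : ℝ)) := by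
      intro k hk
      have hk' : k ≤ j := by
        have := Finset.mem_range.1 hk
        omega
      have h1 : ((i : ℝ) + 1) * (i.choose k : ℝ) =
          (((i + 1).choose (k + 1) : ℕ) : ℝ) * ((k : ℝ) + 1) := by
        exact_mod_cast Nat.add_one_mul_choose_eq i k
      have h2 : ((j : ℝ) + 1) * (j.choose k : ℝ) =
          (((j + 1).choose (k + 1) : ℕ) : ℝ) * ((k : ℝ) + 1) := by
        exact_mod_cast Nat.add_one_mul_choose_eq j k
      have h3 : (0 : ℝ) < j.choose k := by exact_mod_cast Nat.choose_pos hk'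
      have h4 : (0 : ℝ) < ((j + 1).choose (k + 1) : ℕ) := by
        exact_mod_cast Nat.choose_pos (by omega)
      rw [div_mul_div_comm, h1, h2]
      field_simp
    rw [Finset.sum_congr rfl hterm, ← Finset.mul_sum, ih hij]
    have h5 : (0 : ℝ) < (j : ℝ) - i + 1 := by
      have : (i : ℝ) ≤ j := by exact_mod_cast hij
      linarith
    have h6 : ((j : ℝ) + 1) ≠ 0 := by positivity
    push_cast
    have h7 : (j : ℝ) + 1 - (i + 1) + 1 = j - i + 1 := by ring
    rw [h7]
    simp
    field_simp
    ring

section Kernel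

variable {ι : Type*} [Fintype ι] [DecidableEq ι]

/-- This writes the kernel as a nonnegative combination of rank-one kernels. Grouping γ ⊆ α ∩ β by
size reduces it to `sum_choose_div_choose`; for |γ| > j the coefficient is 1 / 0 = 0. -/
lemma one_div_card_sdiff {j : ℕ} {α β : Finset ι} (hα : α.card = j) :
    (1 : ℝ) / ((α \ β).card + 1) =
      ∑ γ : Finset ι, (if γ ⊆ α then 1 else 0) * (if γ ⊆ β then 1 else 0) *
        (1 / (((j : ℝ) + 1) * (j.choose γ.card : ℝ))) := by
  have h1 : ∀ γ : Finset ι, (if γ ⊆ α then (1 : ℝ) else 0) * (if γ ⊆ β then 1 else 0) *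
        (1 / (((j : ℝ) + 1) * (j.choose γ.card : ℝ))) =
      if γ ∈ (α ∩ β).powerset then (1 / (((j : ℝ) + 1) * (j.choose γ.card : ℝ))) else 0 := by
    intro γ
    have hiff : γ ∈ (α ∩ β).powerset ↔ γ ⊆ α ∧ γ ⊆ β := by
      rw [Finset.mem_powerset, Finset.subset_inter_iff]
    simp only [hiff]
    by_cases h : γ ⊆ α <;> by_cases h' : γ ⊆ β <;> simp [h, h']
  rw [Finset.sum_congr rfl fun γ _ => h1 γ, Finset.sum_ite_mem, Finset.univ_inter,
    Finset.sum_powerset_apply_card (fun k => 1 / (((j : ℝ) + 1) * (j.choose k : ℝ)))]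
  have hle : (α ∩ β).card ≤ j := hα ▸ Finset.card_le_card Finset.inter_subset_left
  have hc : ((α \ β).card : ℝ) = j - (α ∩ β).card := by
    have := Finset.card_sdiff_add_card_inter α β
    rw [hα] at this
    rw [← this]
    push_cast
    ring
  have h2 : ∀ k, (α ∩ β).card.choose k • (1 / (((j : ℝ) + 1) * (j.choose k : ℝ))) =
      1 / ((j : ℝ) + 1) * (((α ∩ β).card.choose k : ℝ) / (j.choose k : ℝ)) := by
    intro k
    rw [nsmul_eq_mul, div_mul_div_comm, mul_one_div, one_mul]
  have hj : (j : ℝ) + 1 ≠ 0 := by positivity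
  rw [Finset.sum_congr rfl fun k _ => h2 k, ← Finset.mul_sum, sum_choose_div_choose hle, hc]
  field_simp

/-- The kernel `1 / (|α \ β| + 1)` on the `j`-element sets dominates its average. -/
lemma sq_sum_le_kernel (f : Finset ι → ℝ) {j : ℕ} (hj : j ≤ Fintype.card ι) :
    (∑ α ∈ Finset.univ.powersetCard j, f α) ^ 2 *
        (((Fintype.card ι : ℝ) + 1) / (((j : ℝ) + 1) * ((Fintype.card ι : ℝ) - j + 1))) ≤
      ∑ α ∈ Finset.univ.powersetCard j, ∑ β ∈ Finset.univ.powersetCard j,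
        f α * f β * (1 / (((α \ β).card : ℝ) + 1)) := by
  set n := Fintype.card ι with hn
  set J := (Finset.univ : Finset ι).powersetCard j with hJ
  set g : Finset ι → ℝ := fun γ => ∑ α ∈ J, if γ ⊆ α then f α else 0 with hg
  have hR : ∑ α ∈ J, ∑ β ∈ J, f α * f β * (1 / (((α \ β).card : ℝ) + 1)) =
      ∑ γ : Finset ι, (1 / (((j : ℝ) + 1) * (j.choose γ.card : ℝ))) * g γ ^ 2 := by
    have h1 : ∀ α ∈ J, ∀ β ∈ J, f α * f β * (1 / (((α \ β).card : ℝ) + 1)) =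
        ∑ γ : Finset ι, (1 / (((j : ℝ) + 1) * (j.choose γ.card : ℝ))) *
          ((if γ ⊆ α then f α else 0) * (if γ ⊆ β then f β else 0)) := by
      intro α hα β _
      rw [one_div_card_sdiff (Finset.mem_powersetCard.1 hα).2, Finset.mul_sum]
      refine Finset.sum_congr rfl fun γ _ => ?_
      split_ifs <;> ring
    rw [Finset.sum_congr rfl fun α hα => Finset.sum_congr rfl fun β hβ => h1 α hα β hβ]
    simp_rw [hg, sq, Finset.sum_mul_sum, Finset.mul_sum]
    rw [Finset.sum_congr rfl fun α _ => Finset.sum_comm, Finset.sum_comm]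
  -- Cauchy–Schwarz over the C(n, k) sets γ of size k, C(j, k) of which lie in each α.
  have hlevel : ∀ k ∈ Finset.range (j + 1),
      (j.choose k : ℝ) / (n.choose k : ℝ) * (∑ α ∈ J, f α) ^ 2 ≤
        1 / (j.choose k : ℝ) * ∑ γ ∈ Finset.univ.powersetCard k, g γ ^ 2 := by
    intro k hk
    have hkj : k ≤ j := by
      have := Finset.mem_range.1 hk
      omega
    have hsum : ∑ γ ∈ (Finset.univ : Finset ι).powersetCard k, g γ =
        (j.choose k : ℝ) * ∑ α ∈ J, f α := by
      rw [hg, Finset.sum_comm, Finset.mul_sum]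
      refine Finset.sum_congr rfl fun α hα => ?_
      rw [← Finset.sum_filter, Finset.sum_const, nsmul_eq_mul]
      congr 2
      rw [← (Finset.mem_powersetCard.1 hα).2, ← Finset.card_powersetCard]
      congr 1
      ext γ
      simp [Finset.mem_powersetCard, and_comm]
    have hcs := sq_sum_le_card_mul_sum_sq (s := (Finset.univ : Finset ι).powersetCard k) (f := g)
    rw [hsum, Finset.card_powersetCard, Finset.card_univ, ← hn] at hcs
    have hjk : (0 : ℝ) < j.choose k := by exact_mod_cast Nat.choose_pos hkj
    have hnk : (0 : ℝ) < n.choose k := by exact_mod_cast Nat.choose_pos (hkj.trans hj)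
    rw [div_mul_eq_mul_div, div_le_iff₀ hnk, one_div, inv_mul_eq_div, div_mul_eq_mul_div,
      le_div_iff₀ hjk]
    nlinarith [hcs]
  have hsplit : ∑ γ : Finset ι, (1 / (((j : ℝ) + 1) * (j.choose γ.card : ℝ))) * g γ ^ 2 =
      ∑ k ∈ Finset.range (n + 1), ∑ γ ∈ Finset.univ.powersetCard k,
        (1 / (((j : ℝ) + 1) * (j.choose γ.card : ℝ))) * g γ ^ 2 := by
    rw [← Finset.powerset_univ, Finset.sum_powerset, Finset.card_univ]
  have hsub : ∑ k ∈ Finset.range (j + 1), ∑ γ ∈ Finset.univ.powersetCard k,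
        (1 / (((j : ℝ) + 1) * (j.choose γ.card : ℝ))) * g γ ^ 2 ≤
      ∑ k ∈ Finset.range (n + 1), ∑ γ ∈ Finset.univ.powersetCard k,
        (1 / (((j : ℝ) + 1) * (j.choose γ.card : ℝ))) * g γ ^ 2 := by
    refine Finset.sum_le_sum_of_subset_of_nonneg
      (Finset.range_subset_range.2 (by omega)) fun k _ _ => Finset.sum_nonneg fun γ _ => ?_
    positivity
  rw [hR, hsplit]
  refine le_trans ?_ hsub
  have h3 : ∀ k ∈ Finset.range (j + 1), 1 / ((j : ℝ) + 1) *
      ((j.choose k : ℝ) / (n.choose k : ℝ) * (∑ α ∈ J, f α) ^ 2) ≤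
      ∑ γ ∈ Finset.univ.powersetCard k,
        (1 / (((j : ℝ) + 1) * (j.choose γ.card : ℝ))) * g γ ^ 2 := by
    intro k hk
    refine (mul_le_mul_of_nonneg_left (hlevel k hk) (by positivity)).trans (le_of_eq ?_)
    rw [← mul_assoc, Finset.mul_sum]
    refine Finset.sum_congr rfl fun γ hγ => ?_
    rw [(Finset.mem_powersetCard.1 hγ).2, one_div_mul_one_div]
  refine le_trans (le_of_eq ?_) (Finset.sum_le_sum h3)
  rw [← Finset.mul_sum, ← Finset.sum_mul, sum_choose_div_choose hj]
  have h4 : (0 : ℝ) < (n : ℝ) - j + 1 := by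
    have : (j : ℝ) ≤ n := by exact_mod_cast hj
    linarith
  have h5 : (j : ℝ) + 1 ≠ 0 := by positivity
  field_simp

/-- A sum over pairs of sets, arranged by intersection and symmetric difference. -/
lemma sum_pairs_eq (G : Finset ι → Finset ι → ℝ) :
    ∑ α : Finset ι, ∑ β : Finset ι, G α β =
      ∑ γ : Finset ι, ∑ η ∈ (γᶜ).powerset, ∑ a ∈ η.powerset, G (γ ∪ a) (γ ∪ (η \ a)) := by
  rw [← Finset.sum_product', Finset.sum_sigma', Finset.sum_sigma']
  refine Finset.sum_nbij'
    (fun x => ⟨⟨x.1 ∩ x.2, (x.1 \ x.2) ∪ (x.2 \ x.1)⟩, x.1 \ x.2⟩)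
    (fun y => (y.1.1 ∪ y.2, y.1.1 ∪ (y.1.2 \ y.2))) ?_ ?_ ?_ ?_ ?_
  · rintro ⟨α, β⟩ -
    simp only [Finset.mem_sigma, Finset.mem_univ, Finset.mem_powerset, true_and]
    constructor
    · intro x hx
      simp at hx ⊢
      tauto
    · exact Finset.subset_union_left
  · intro y _
    simp
  · rintro ⟨α, β⟩ -
    simp only [Prod.mk.injEq]
    constructor <;> ext x <;> simp <;> tauto
  · rintro ⟨⟨γ, η⟩, a⟩ hy
    simp only [Finset.mem_sigma, Finset.mem_univ, Finset.mem_powerset, true_and] at hy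
    obtain ⟨h1, h2⟩ := hy
    have h3 : ∀ x, x ∈ η → x ∉ γ := fun x hx => by simpa using h1 hx
    have e1 : (γ ∪ a) ∩ (γ ∪ (η \ a)) = γ := by
      ext x; simp; tauto
    have e2 : (γ ∪ a) \ (γ ∪ (η \ a)) = a := by
      ext x
      have := h3 x
      have := @h2 x
      simp; tauto
    have e3 : (γ ∪ a) \ (γ ∪ (η \ a)) ∪ (γ ∪ (η \ a)) \ (γ ∪ a) = η := by
      ext x
      have := h3 x
      have := @h2 x
      simp; tauto
    simp only [e1, e3]
    simp only [e2]
  · rintro ⟨α, β⟩ -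
    congr 1 <;> ext x <;> simp <;> tauto

end Kernel

/-! ### Newton's inequality for nonsingular M-matrices -/

section Newton

variable {ι : Type*} [Fintype ι] [DecidableEq ι]

/-- The sum of the principal minors of order `j`. -/
noncomputable def minorSum (S : Matrix ι ι ℝ) (j : ℕ) : ℝ :=
  ∑ α ∈ Finset.univ.powersetCard j, pminor S α

/-- For |η| = 2(p + 1), `sum_pminor_union_step` has factors p + 2 and p + 1. Their ratio (p + 1) /
(p + 2) is the weight on the right, since there |α \ β| = p + 1. -/
lemma minorSum_mul_minorSum_le {S : Matrix ι ι ℝ} (h : IsSemipositiveZ S Finset.univ) (j : ℕ) :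
    minorSum S j * minorSum S (j + 2) ≤
      ∑ α ∈ Finset.univ.powersetCard (j + 1), ∑ β ∈ Finset.univ.powersetCard (j + 1),
        pminor S α * pminor S β * (1 - 1 / (((α \ β).card : ℝ) + 1)) := by
  set f := pminor S with hf
  have hall : ∀ (k l : ℕ) (G : Finset ι → Finset ι → ℝ),
      ∑ α ∈ Finset.univ.powersetCard k, ∑ β ∈ Finset.univ.powersetCard l, G α β =
        ∑ α : Finset ι, ∑ β : Finset ι, if α.card = k ∧ β.card = l then G α β else 0 := by
    intro k l G
    have hk : ∀ k, (Finset.univ : Finset ι).powersetCard k =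
        Finset.univ.filter fun α => α.card = k := by
      intro k
      ext α
      simp [Finset.mem_powersetCard]
    rw [hk k, hk l, Finset.sum_filter]
    refine Finset.sum_congr rfl fun α _ => ?_
    rw [Finset.sum_filter]
    by_cases hα : α.card = k
    · simp only [hα, if_true, true_and]
    · simp [hα]
  rw [minorSum, minorSum, Finset.sum_mul_sum, hall, hall, sum_pairs_eq, sum_pairs_eq]
  refine Finset.sum_le_sum fun γ _ => Finset.sum_le_sum fun η hη => ?_
  have hdis : Disjoint γ η := by
    rw [Finset.mem_powerset, Finset.subset_compl_iff_disjoint_right] at hη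
    exact hη.symm
  have hsub : ∀ a ∈ η.powerset, (γ ∪ a).card = γ.card + a.card ∧
      (γ ∪ (η \ a)).card + a.card = γ.card + η.card ∧ (γ ∪ a) \ (γ ∪ (η \ a)) = a := by
    intro a ha
    rw [Finset.mem_powerset] at ha
    refine ⟨Finset.card_union_of_disjoint (Finset.disjoint_of_subset_right ha hdis), ?_, ?_⟩
    · rw [Finset.card_union_of_disjoint (Finset.disjoint_of_subset_right Finset.sdiff_subset hdis),
        add_assoc, Finset.card_sdiff_add_card_eq_card ha]
    · ext x
      have h1 : x ∈ η → x ∉ γ := fun hx hxγ => Finset.disjoint_left.1 hdis hxγ hx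
      have h2 := @ha x
      simp
      tauto
  by_cases hm : ∃ p, η.card = 2 * (p + 1) ∧ γ.card + p = j
  · obtain ⟨p, hη2, hγ⟩ := hm
    have hL : ∑ a ∈ η.powerset, (if (γ ∪ a).card = j ∧ (γ ∪ (η \ a)).card = j + 2 then
        f (γ ∪ a) * f (γ ∪ (η \ a)) else 0) =
        ∑ a ∈ η.powersetCard p, f (γ ∪ a) * f (γ ∪ (η \ a)) := by
      rw [Finset.powersetCard_eq_filter, Finset.sum_filter]
      refine Finset.sum_congr rfl fun a ha => if_congr ?_ rfl rfl
      obtain ⟨h1, h2, -⟩ := hsub a ha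
      omega
    have hR : ∑ a ∈ η.powerset, (if (γ ∪ a).card = j + 1 ∧ (γ ∪ (η \ a)).card = j + 1 then
        f (γ ∪ a) * f (γ ∪ (η \ a)) *
          (1 - 1 / ((((γ ∪ a) \ (γ ∪ (η \ a))).card : ℝ) + 1)) else 0) =
        (∑ a ∈ η.powersetCard (p + 1), f (γ ∪ a) * f (γ ∪ (η \ a))) *
          (1 - 1 / ((p : ℝ) + 1 + 1)) := by
      rw [Finset.powersetCard_eq_filter, Finset.sum_filter, Finset.sum_mul]
      refine Finset.sum_congr rfl fun a ha => ?_
      obtain ⟨h1, h2, h3⟩ := hsub a ha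
      rw [h3, ite_mul, zero_mul]
      by_cases hap : a.card = p + 1
      · rw [if_pos (by omega), if_pos hap, hap]
        push_cast
        rfl
      · rw [if_neg (by omega), if_neg hap]
    have hS : IsSemipositiveZ S (γ ∪ η) := h.mono (Finset.subset_univ _)
    have key := sum_pminor_union_step hdis hS (p := p) (by omega)
    rw [hL, hR]
    rw [hη2] at key
    push_cast at key
    have hp : (0 : ℝ) < (p : ℝ) + 1 + 1 := by positivity
    have he : (1 - 1 / ((p : ℝ) + 1 + 1)) = (p + 1) / (p + 1 + 1) := by
      field_simp
      ring
    rw [he, mul_div_assoc', le_div_iff₀ hp]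
    linarith
  -- In the other fibres no pair counts on the left, and on the right only α = β can occur, with
  -- weight zero.
  · refine le_of_eq ?_
    rw [Finset.sum_eq_zero, Finset.sum_eq_zero]
    · intro a ha
      obtain ⟨h1, h2, h3⟩ := hsub a ha
      by_cases h0 : a.card = 0
      · simp [h3, h0]
      · rw [if_neg]
        intro hc
        exact hm ⟨a.card - 1, by omega, by omega⟩
    · intro a ha
      obtain ⟨h1, h2, h3⟩ := hsub a ha
      rw [if_neg]
      intro hc
      exact hm ⟨a.card, by omega, by omega⟩

lemma minorSum_newton_of_isSemipositiveZ {S : Matrix ι ι ℝ}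
    (h : IsSemipositiveZ S Finset.univ) {j : ℕ} (hj : j + 2 ≤ Fintype.card ι) :
    minorSum S j * minorSum S (j + 2) * ((j + 2) * ((Fintype.card ι : ℝ) - j)) ≤
      minorSum S (j + 1) ^ 2 * ((j + 1) * ((Fintype.card ι : ℝ) - j - 1)) := by
  have h1 := minorSum_mul_minorSum_le h j
  have h2 := sq_sum_le_kernel (pminor S) (j := j + 1) (by omega)
  have h3 : ∑ α ∈ Finset.univ.powersetCard (j + 1), ∑ β ∈ Finset.univ.powersetCard (j + 1),
        pminor S α * pminor S β * (1 - 1 / (((α \ β).card : ℝ) + 1)) =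
      minorSum S (j + 1) ^ 2 -
        ∑ α ∈ Finset.univ.powersetCard (j + 1), ∑ β ∈ Finset.univ.powersetCard (j + 1),
          pminor S α * pminor S β * (1 / (((α \ β).card : ℝ) + 1)) := by
    simp only [mul_sub, mul_one, Finset.sum_sub_distrib, sq, minorSum, Finset.sum_mul_sum]
  rw [h3] at h1
  rw [← minorSum] at h2
  set n : ℝ := (Fintype.card ι : ℝ) with hn
  have hjn : (j : ℝ) + 2 ≤ n := by
    rw [hn]
    exact_mod_cast hj
  have h4 := h1.trans (sub_le_sub_left h2 _)
  push_cast at h4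
  have h5 : (0 : ℝ) < (j + 2) * (n - j) := mul_pos (by positivity) (by linarith)
  have h6 : minorSum S (j + 1) ^ 2 - minorSum S (j + 1) ^ 2 *
      ((n + 1) / (((j : ℝ) + 1 + 1) * (n - (j + 1) + 1))) =
      minorSum S (j + 1) ^ 2 * ((j + 1) * (n - j - 1)) / ((j + 2) * (n - j)) := by
    have e1 : (j : ℝ) + 1 + 1 = j + 2 := by ring
    have e2 : n - ((j : ℝ) + 1) + 1 = n - j := by ring
    have e3 : (j : ℝ) + 2 ≠ 0 := by positivity
    have e4 : n - (j : ℝ) ≠ 0 := by linarith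
    rw [e1, e2]
    field_simp
    ring
  rwa [h6, le_div_iff₀ h5] at h4

/-! ### Singular M-matrices by perturbation -/

/-- The polynomial det(1 + tN) has the minor sums as coefficients and constant term 1, so it is
positive at t = ε⁻¹. -/
lemma det_add_smul_one_pos {N : Matrix ι ι ℝ} (hN : ∀ a, 0 ≤ pminor N a) {ε : ℝ} (hε : 0 < ε) :
    0 < (N + ε • (1 : Matrix ι ι ℝ)).det := by
  set q : Polynomial ℝ := (1 + (Polynomial.X : Polynomial ℝ) • N.map Polynomial.C).det with hq
  have hcoeff : ∀ k, q.coeff k = minorSum N k := fun k =>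
    Matrix.coeff_det_one_add_X_smul_eq_sum_minors N k
  have heval : q.eval ε⁻¹ = (1 + ε⁻¹ • N).det := by
    rw [hq, ← Polynomial.coe_evalRingHom, RingHom.map_det]
    congr 1
    ext i j
    by_cases hij : i = j
    · subst hij
      simp
      exact mul_comm _ _
    · simp [hij]
      exact mul_comm _ _
  have hpos : 0 < q.eval ε⁻¹ := by
    rw [Polynomial.eval_eq_sum_range, Finset.sum_range_succ']
    have h0 : q.coeff 0 = 1 := by simp [hcoeff, minorSum]
    rw [h0, pow_zero, mul_one]
    refine add_pos_of_nonneg_of_pos (Finset.sum_nonneg fun k _ => ?_) one_pos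
    rw [hcoeff]
    exact mul_nonneg (Finset.sum_nonneg fun a _ => hN a) (by positivity)
  have : N + ε • (1 : Matrix ι ι ℝ) = ε • (1 + ε⁻¹ • N) := by
    rw [smul_add, smul_smul, mul_inv_cancel₀ hε.ne', one_smul, add_comm]
  rw [this, Matrix.det_smul, ← heval]
  positivity

end Newton

lemma pminor_submatrix {ι : Type*} [DecidableEq ι] (S : Matrix ι ι ℝ) (a : Finset ι) (s : Finset a) :
    pminor (S.submatrix (Subtype.val : a → ι) Subtype.val) s =
      pminor S (s.map (Function.Embedding.subtype _)) := by
  let e : s ≃ s.map (Function.Embedding.subtype (· ∈ a)) :=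
    Equiv.ofBijective (fun i => ⟨i, Finset.mem_map_of_mem _ i.2⟩)
      ⟨fun i j h => Subtype.ext (Subtype.ext (Subtype.mk.inj h)), fun ⟨i, hi⟩ => by
        obtain ⟨k, hk, rfl⟩ := Finset.mem_map.1 hi
        exact ⟨⟨k, hk⟩, rfl⟩⟩
  rw [pminor, pminor, ← Matrix.det_submatrix_equiv_self e]
  rfl

lemma pminor_add_smul_one_pos {ι : Type*} [DecidableEq ι] {S : Matrix ι ι ℝ} (hS : ∀ a, 0 ≤ pminor S a) {ε : ℝ}
    (hε : 0 < ε) (a : Finset ι) : 0 < pminor (S + ε • (1 : Matrix ι ι ℝ)) a := by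
  have := det_add_smul_one_pos (N := S.submatrix (Subtype.val : a → ι) Subtype.val)
    (fun s => by rw [pminor_submatrix]; exact hS _) hε
  rw [pminor]
  convert this using 2
  ext i j
  simp only [Matrix.submatrix_apply, Matrix.add_apply, Matrix.smul_apply, Matrix.one_apply,
    Subtype.val_inj]

theorem minorSum_newton {ι : Type*} [Fintype ι] [DecidableEq ι] {S : Matrix ι ι ℝ} (hS : ∀ a, 0 ≤ pminor S a)
    (hz : ∀ i j, i ≠ j → S i j ≤ 0) {j : ℕ} (hj : j + 2 ≤ Fintype.card ι) :
    minorSum S j * minorSum S (j + 2) * ((j + 2) * ((Fintype.card ι : ℝ) - j)) ≤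
      minorSum S (j + 1) ^ 2 * ((j + 1) * ((Fintype.card ι : ℝ) - j - 1)) := by
  have hc : ∀ k, Continuous fun ε : ℝ => minorSum (S + ε • (1 : Matrix ι ι ℝ)) k := by
    intro k
    unfold minorSum pminor
    refine continuous_finsetSum _ fun a _ => Continuous.matrix_det ?_
    refine Continuous.matrix_submatrix ?_ _ _
    fun_prop
  have hlim : ∀ G : ℝ → ℝ, Continuous G →
      Filter.Tendsto G (nhdsWithin 0 (Set.Ioi 0)) (nhds (G 0)) := fun G hG =>
    hG.continuousAt.tendsto.mono_left nhdsWithin_le_nhds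
  have h1 := hlim (fun ε => minorSum (S + ε • (1 : Matrix ι ι ℝ)) j *
    minorSum (S + ε • (1 : Matrix ι ι ℝ)) (j + 2) * ((j + 2) * ((Fintype.card ι : ℝ) - j)))
    (((hc j).mul (hc (j + 2))).mul continuous_const)
  have h2 := hlim (fun ε => minorSum (S + ε • (1 : Matrix ι ι ℝ)) (j + 1) ^ 2 *
    ((j + 1) * ((Fintype.card ι : ℝ) - j - 1))) (((hc (j + 1)).pow 2).mul continuous_const)
  simp only [zero_smul, add_zero] at h1 h2
  refine le_of_tendsto_of_tendsto h1 h2 ?_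
  filter_upwards [self_mem_nhdsWithin] with ε hε
  refine minorSum_newton_of_isSemipositiveZ (isSemipositiveZ_of_pminor_pos ?_ ?_) hj
  · intro i _ k _ hik
    simpa [Matrix.one_apply, hik] using hz i k hik
  · exact fun a _ => pminor_add_smul_one_pos hS hε a

/-! ### Normalization, inverses and similarity -/

lemma minorSum_newton_normalized {n : ℕ} {S : Matrix (Fin n) (Fin n) ℝ} (hS : IsMMatrix S)
    {j : ℕ} (hj : j + 2 ≤ n) :
    minorSum S j / n.choose j * (minorSum S (j + 2) / n.choose (j + 2)) ≤
      (minorSum S (j + 1) / n.choose (j + 1)) ^ 2 := by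
  have h := minorSum_newton (S := S) (fun a => hS.1 a) hS.2 (j := j) (by simpa using hj)
  rw [Fintype.card_fin] at h
  have e1 : (n.choose (j + 1) : ℝ) * (j + 1) = n.choose j * ((n : ℝ) - j) := by
    have := Nat.choose_succ_right_eq n j
    rw [← Nat.cast_sub (by omega)]
    exact_mod_cast this
  have e2 : (n.choose (j + 2) : ℝ) * (j + 2) = n.choose (j + 1) * ((n : ℝ) - j - 1) := by
    have := Nat.choose_succ_right_eq n (j + 1)
    rw [sub_sub, show (j : ℝ) + 1 = ((j + 1 : ℕ) : ℝ) by push_cast; rfl,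
      ← Nat.cast_sub (by omega)]
    exact_mod_cast this
  have p0 : (0 : ℝ) < n.choose j := by exact_mod_cast Nat.choose_pos (by omega)
  have p1 : (0 : ℝ) < n.choose (j + 1) := by exact_mod_cast Nat.choose_pos (by omega)
  have p2 : (0 : ℝ) < n.choose (j + 2) := by exact_mod_cast Nat.choose_pos (by omega)
  have hjn : (j : ℝ) + 2 ≤ n := by exact_mod_cast hj
  have hnj : (0 : ℝ) < n - j := by linarith
  rw [div_mul_div_comm, div_pow, div_le_div_iff₀ (mul_pos p0 p2) (by positivity)]
  have hc : (0 : ℝ) < (j + 2) * (n - j) := mul_pos (by positivity) hnj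
  refine le_of_mul_le_mul_right ?_ hc
  have e3 : (n.choose j : ℝ) * n.choose (j + 2) * ((j + 2) * (n - j)) =
      (n.choose (j + 1) : ℝ) ^ 2 * ((j + 1) * (n - j - 1)) := by
    calc (n.choose j : ℝ) * n.choose (j + 2) * ((j + 2) * (n - j))
        = (n.choose j * (n - j)) * (n.choose (j + 2) * (j + 2)) := by ring
      _ = (n.choose (j + 1) * (j + 1)) * (n.choose (j + 1) * (n - j - 1)) := by rw [e1, e2]
      _ = _ := by ring
  calc minorSum S j * minorSum S (j + 2) * (n.choose (j + 1) : ℝ) ^ 2 * ((j + 2) * (n - j))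
      = minorSum S j * minorSum S (j + 2) * ((j + 2) * (n - j)) *
          (n.choose (j + 1) : ℝ) ^ 2 := by ring
    _ ≤ minorSum S (j + 1) ^ 2 * ((j + 1) * (n - j - 1)) * (n.choose (j + 1) : ℝ) ^ 2 :=
        mul_le_mul_of_nonneg_right h (sq_nonneg _)
    _ = minorSum S (j + 1) ^ 2 * ((n.choose j : ℝ) * n.choose (j + 2)) * ((j + 2) * (n - j)) := by
        rw [mul_assoc (minorSum S (j + 1) ^ 2) (_ * _) ((j + 2) * _), e3]
        ring

/-- The characteristic polynomial of S is, up to the factor (-1)^n det S, the reversal of that of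
S⁻¹; the identity compares coefficients of degree n - j. -/
lemma minorSum_eq_of_isUnit {n : ℕ} {S : Matrix (Fin n) (Fin n) ℝ} (hS : IsUnit S)
    {j : ℕ} (hj : j ≤ n) : minorSum S j = S.det * minorSum S⁻¹ (n - j) := by
  have hdet : IsUnit S.det := (Matrix.isUnit_iff_isUnit_det S).1 hS
  have h := Matrix.charpoly_inv S⁻¹ ((Matrix.isUnit_nonsing_inv_iff).2 hS)
  rw [Matrix.nonsing_inv_nonsing_inv S hdet, Matrix.det_nonsing_inv, Ring.inverse_inverse hdet,
    ← Matrix.reverse_charpoly] at h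
  have h1 := congrArg (fun p => Polynomial.coeff p (n - j)) h
  have h2 := Matrix.charpoly_coeff_eq_sum_minors S j (by simpa using hj)
  have h3 := Matrix.charpoly_coeff_eq_sum_minors S⁻¹ (n - j) (by simp)
  simp only [Fintype.card_fin] at h1 h2 h3
  rw [show n - (n - j) = j by omega] at h3
  have h4 : (S⁻¹).charpoly.reverse.coeff (n - j) = (S⁻¹).charpoly.coeff j := by
    rw [Polynomial.coeff_reverse, Matrix.charpoly_natDegree_eq_dim, Fintype.card_fin,
      Polynomial.revAt_le (by omega)]
    congr 1
    omega
  have h5 : ((-1 : Polynomial ℝ)) ^ n = Polynomial.C ((-1) ^ n) := by simp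
  rw [h5, mul_assoc, Polynomial.coeff_C_mul, Polynomial.coeff_C_mul, h2, h4, h3] at h1
  change (-1) ^ j * minorSum S j = (-1) ^ n * (S.det * ((-1) ^ (n - j) * minorSum S⁻¹ (n - j))) at h1
  have h6 : (-1 : ℝ) ^ n = (-1) ^ j * (-1) ^ (n - j) := by
    rw [← pow_add]
    congr 1
    omega
  have h7 : ((-1 : ℝ) ^ (n - j)) * (-1) ^ (n - j) = 1 := by
    rw [← mul_pow]
    simp
  have h8 : ((-1 : ℝ) ^ j) ≠ 0 := by simp
  refine mul_left_cancel₀ h8 (h1.trans ?_)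
  rw [h6]
  linear_combination ((-1 : ℝ) ^ j * S.det * minorSum S⁻¹ (n - j)) * h7

lemma sum_principalMinor_eq_of_similar {n : ℕ} {A B : Matrix (Fin n) (Fin n) ℂ}
    (h : Similar A B) {j : ℕ} (hj : j ≤ n) :
    ∑ α ∈ Finset.univ.powersetCard j, principalMinor A α =
      ∑ α ∈ Finset.univ.powersetCard j, principalMinor B α := by
  obtain ⟨T, hT, rfl⟩ := h
  have h1 := Matrix.charpoly_coeff_eq_sum_minors (T * B * T⁻¹) j (by simpa using hj)
  have h2 := Matrix.charpoly_coeff_eq_sum_minors B j (by simpa using hj)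
  have h3 : (T * B * T⁻¹).charpoly = B.charpoly := by
    obtain ⟨u, rfl⟩ := hT
    exact Matrix.charpoly_units_conj u B
  rw [h3, h2] at h1
  exact (mul_left_cancel₀ (by simp) h1).symm

lemma principalMinor_map_ofReal {n : ℕ} (M : Matrix (Fin n) (Fin n) ℝ) (α : Finset (Fin n)) :
    principalMinor (M.map fun x : ℝ => (x : ℂ)) α = (pminor M α : ℝ) := by
  rw [pminor, principalMinor]
  exact (RingHom.map_det Complex.ofRealHom _).symm

lemma normCoeff_eq_of_similar {n : ℕ} {A : Matrix (Fin n) (Fin n) ℂ}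
    {M : Matrix (Fin n) (Fin n) ℝ} (h : Similar A (M.map fun x : ℝ => (x : ℂ)))
    {j : ℕ} (hj : j ≤ n) : normCoeff A j = ((minorSum M j / n.choose j : ℝ) : ℂ) := by
  rw [normCoeff, sum_principalMinor_eq_of_similar h hj, minorSum]
  push_cast
  simp only [principalMinor_map_ofReal]

end NewtonMMatrix

theorem mainTheorem1 {n : ℕ} (A : Matrix (Fin n) (Fin n) ℂ)
    (hA : ∃ M : Matrix (Fin n) (Fin n) ℝ,
      (NewtonMMatrix.IsMMatrix M ∨ NewtonMMatrix.IsInverseMMatrix M) ∧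
        NewtonMMatrix.Similar A (M.map (fun x : ℝ => (x : ℂ)))) :
    (∀ j : ℕ, j ≤ n → (NewtonMMatrix.normCoeff A j).im = 0) ∧
    ∀ j : ℕ, 1 ≤ j → j + 1 ≤ n →
      (NewtonMMatrix.normCoeff A (j - 1)).re * (NewtonMMatrix.normCoeff A (j + 1)).re ≤
        (NewtonMMatrix.normCoeff A j).re ^ 2 := by
  obtain ⟨M, hM, hsim⟩ := hA
  refine ⟨fun j hj => ?_, fun j hj1 hjn => ?_⟩
  · rw [NewtonMMatrix.normCoeff_eq_of_similar hsim hj, Complex.ofReal_im]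
  obtain ⟨k, rfl⟩ : ∃ k, j = k + 1 := ⟨j - 1, by omega⟩
  rw [Nat.add_sub_cancel, NewtonMMatrix.normCoeff_eq_of_similar hsim (j := k) (by omega),
    NewtonMMatrix.normCoeff_eq_of_similar hsim (j := k + 1) (by omega),
    NewtonMMatrix.normCoeff_eq_of_similar hsim (j := k + 1 + 1) (by omega),
    Complex.ofReal_re, Complex.ofReal_re, Complex.ofReal_re]
  rcases hM with hM | ⟨hu, hM⟩
  · exact NewtonMMatrix.minorSum_newton_normalized hM hjn
  -- Orders k, k + 1, k + 2 of M correspond to l + 2, l + 1, l of M⁻¹. The inequality is symmetric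
  -- under this reversal and gets multiplied by (det M)^2.
  · obtain ⟨l, rfl⟩ : ∃ l, n = k + 2 + l := ⟨n - (k + 2), by omega⟩
    have key := NewtonMMatrix.minorSum_newton_normalized hM (j := l) (by omega)
    rw [NewtonMMatrix.minorSum_eq_of_isUnit hu (j := k) (by omega),
      NewtonMMatrix.minorSum_eq_of_isUnit hu (j := k + 1) (by omega),
      NewtonMMatrix.minorSum_eq_of_isUnit hu (j := k + 1 + 1) (by omega),
      ← Nat.choose_symm (show k ≤ k + 2 + l by omega),
      ← Nat.choose_symm (show k + 1 ≤ k + 2 + l by omega),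
      ← Nat.choose_symm (show k + 1 + 1 ≤ k + 2 + l by omega),
      show k + 2 + l - k = l + 2 by omega, show k + 2 + l - (k + 1) = l + 1 by omega,
      show k + 2 + l - (k + 1 + 1) = l by omega]
    have := mul_le_mul_of_nonneg_left key (sq_nonneg M.det)
    calc _ = _ := by ring
      _ ≤ _ := this
      _ = _ := by ring
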